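/- Let $S$, $A$, $\Sigma$ be finite sets with $A\neq\emptyset$. A multi-task MDP $\mathcal M=(S,A,P,\Sigma,R,F,T,\gamma,\eta,\sigma_0)$ consists of transition probabilities $P(\cdot\mid s,a)$ on $S$ (for $s\in S$, $a\in A$), a discount factor $\gamma\in(0,1)$, an initial distribution $\eta$ on $S$, an initial subtask $\sigma_0\in\Sigma$ and, for every subtask $\sigma\in\Sigma$, a reward function $R_\sigma:S\times A\to\mathbb R$, a set $F_\sigma\subseteq S$ of final states and, for every $s\in F_\sigma$, a jump distribution $T_\sigma(\cdot\mid s)$ on $S$ with $T_\sigma(s'\mid s)=0$ whenever $s'\in\bigcup_{\sigma'\in\Sigma}F_{\sigma'}$. Consider the two-player zero-sum Markov game $\mathcal G$ with states $\bar S=S\times\Sigma$, actions $A$ of the maximizing agent 1 and actions $\Sigma$ of the minimizing agent 2, in which $$\bar P\big((s',\sigma')\mid(s,\sigma),a_1,a_2\big)=\begin{cases}P(s'\mid s,a_1)&\text{if } s\notin F_\sigma,\ \sigma'=\sigma,\\ T_\sigma(s'\mid s)&\text{if } s\in F_\sigma,\ \sigma'=a_2,\\ 0&\text{otherwise,}\end{cases}$$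 $\bar R((s,\sigma),a)=R_\sigma(s,a)$ and $\bar\gamma(s,\sigma)=\gamma$ if $s\notin F_\sigma$, and $\bar R((s,\sigma),a)=0$ and $\bar\gamma(s,\sigma)=1$ if $s\in F_\sigma$. For deterministic policies $\pi_1:\bar S\to A$ and $\pi_2:\bar S\to\Sigma$ put $$V^{\pi_1,\pi_2}(\bar s)=\mathbb E\Big[\sum_{t=0}^\infty\Big(\prod_{k=0}^{t-1}\bar\gamma(\bar s_k)\Big)\bar R(\bar s_t,a^1_t)\Big],$$ where the run $\bar s_0a_0^1a_0^2\bar s_1a_1^1a_1^2\ldots$ starts at $\bar s_0=\bar s$ and is generated by $\pi_1,\pi_2$, and let $V^*(\bar s)=\max_{\pi_1}\min_{\pi_2}V^{\pi_1,\pi_2}(\bar s)$. Let $S_1=\{(s,\sigma)\in\bar S: s\notin F_\sigma\}$ and let $\mathcal V$ be the set of all functions $V:S_1\to\mathbb R$, with the $\ell_\infty$-norm. For $V\in\mathcal V$ let $[\![V]\!]:\bar S\to\mathbb R$ be its worst-case extension $$[\![V]\!](s,\sigma)=\begin{cases}\min_{\sigma'\in\Sigma}\sum_{s'\in S}T_\sigma(s'\mid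 s)V(s',\sigma')&\text{if } s\in F_\sigma,\\ V(s,\sigma)&\text{otherwise}\end{cases}$$ (terms with $s'\in F_{\sigma'}$ have weight $0$ and are read as $0$), and define $\mathcal F:\mathcal V\to\mathcal V$ by $$\mathcal F(V)(s,\sigma)=\max_{a\in A}\Big\{\bar R((s,\sigma),a)+\gamma\sum_{s'\in S}P(s'\mid s,a)[\![V]\!](s',\sigma)\Big\},\qquad (s,\sigma)\in S_1.$$ Then $\mathcal F$ is a $\gamma$-contraction with respect to the $\ell_\infty$-norm, that is, $\|\mathcal F(V)-\mathcal F(W)\|_\infty\le\gamma\|V-W\|_\infty$ for all $V,W\in\mathcal V$; the restriction $V^*\!\downarrow_{S_1}$ of $V^*$ to $S_1$ is the unique fixed point of $\mathcal F$; and $\lim_{n\to\infty}\mathcal F^n(V)=V^*\!\downarrow_{S_1}$ for every $V\in\mathcal V$. -/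

import Mathlib

open MeasureTheory ProbabilityTheory Filter Topology

noncomputable section

/-- A multi-task Markov decision process with states `S`, actions `A` and subtasks `Subtask`. -/
structure MultiTaskMDP (S A Subtask : Type*) where
  /-- `P s a` is the distribution of the next state after action `a` in state `s`. -/
  P : S → A → PMF S
  /-- the reward function of each subtask -/
  R : Subtask → S → A → ℝ
  /-- the final states of each subtask -/
  F : Subtask → Set S
  /-- `T σ s` is the distribution of the state to which the system jumps from the final state `s`
  of the subtask `σ`. -/
  T : (σ : Subtask) → F σ → PMF S
  /-- a jump never leads to a state that is final for some subtask -/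
  T_eq_zero : ∀ (σ : Subtask) (s : F σ) (σ' : Subtask) (s' : S), s' ∈ F σ' → T σ s s' = 0
  /-- the discount factor -/
  γ : ℝ
  γ_pos : 0 < γ
  γ_lt_one : γ < 1
  /-- the initial state distribution -/
  η : PMF S
  /-- the initial subtask -/
  σ₀ : Subtask

/-- A two-agent zero-sum Markov game with states `X`, actions `A₁` of agent 1 (who maximizes),
actions `A₂` of agent 2 (who minimizes) and a discount factor that depends on the state. -/
structure MarkovGame (X A₁ A₂ : Type*) where
  trans : X → A₁ → A₂ → PMF X
  reward : X → A₁ → ℝ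
  discount : X → ℝ
  init : PMF X

namespace MarkovGame

variable {X A₁ A₂ : Type*} (G : MarkovGame X A₁ A₂)

/-- One step of the Markov chain on states that is induced by deterministic policies `π₁`, `π₂`;
every set of states is measurable. -/
def stepKernel (π₁ : X → A₁) (π₂ : X → A₂) : @Kernel X X ⊤ ⊤ :=
  letI : MeasurableSpace X := ⊤
  { toFun := fun x => (G.trans x (π₁ x) (π₂ x)).toMeasure
    measurable' := measurable_from_top }

instance isMarkovKernel_stepKernel (π₁ : X → A₁) (π₂ : X → A₂) :
    @IsMarkovKernel X X ⊤ ⊤ (G.stepKernel π₁ π₂) :=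
  letI : MeasurableSpace X := ⊤
  ⟨fun x => PMF.toMeasure.isProbabilityMeasure (G.trans x (π₁ x) (π₂ x))⟩

/-- The σ-algebra on infinite sequences that is generated by the coordinates, when every set of
values of a coordinate is measurable. -/
abbrev seqSpace (Y : Type*) : MeasurableSpace (ℕ → Y) :=
  @MeasurableSpace.pi ℕ (fun _ => Y) (fun _ => ⊤)

/-- The law of the sequence of states under `π₁`, `π₂`, started at `x`: the Markov chain with
kernel `stepKernel`, obtained from the Ionescu-Tulcea theorem. -/
def stateLaw (π₁ : X → A₁) (π₂ : X → A₂) (x : X) : @Measure (ℕ → X) (seqSpace X) :=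
  letI : MeasurableSpace X := ⊤
  Kernel.traj (X := fun _ : ℕ => X)
    (fun n => (G.stepKernel π₁ π₂).comap
      (fun h : (i : Finset.Iic n) → X => h ⟨n, Finset.mem_Iic.2 le_rfl⟩)
      (measurable_pi_apply _)) 0 (fun _ => x)

/-- The distribution over runs: the states form the Markov chain above and, at every time, the
actions are those that `π₁` and `π₂` choose in the current state. -/
def runLaw (π₁ : X → A₁) (π₂ : X → A₂) (x : X) :
    @Measure (ℕ → X × A₁ × A₂) (seqSpace (X × A₁ × A₂)) :=
  @Measure.map _ _ (seqSpace X) (seqSpace (X × A₁ × A₂))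
    (fun s t => (s t, π₁ (s t), π₂ (s t))) (G.stateLaw π₁ π₂ x)

/-- The total discounted reward of a run; the reward at time `t` is discounted by the product of
the discount factors of the states visited before `t`. -/
def totalReward (ρ : ℕ → X × A₁ × A₂) : ℝ :=
  ∑' t : ℕ, (∏ k ∈ Finset.range t, G.discount (ρ k).1) * G.reward (ρ t).1 (ρ t).2.1

/-- The value `V^{π₁,π₂}(x)`: the expected total discounted reward. -/
def value (π₁ : X → A₁) (π₂ : X → A₂) (x : X) : ℝ :=
  @integral (ℕ → X × A₁ × A₂) ℝ _ _ (seqSpace (X × A₁ × A₂)) (G.runLaw π₁ π₂ x) G.totalReward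

/-- The optimal value `V*(x) = max_{π₁} min_{π₂} V^{π₁,π₂}(x)` over deterministic policies (for
finite games there are finitely many policies, so the extrema are attained). -/
def optValue (x : X) : ℝ :=
  ⨆ π₁ : X → A₁, ⨅ π₂ : X → A₂, G.value π₁ π₂ x

end MarkovGame

namespace MultiTaskMDP

variable {S A Subtask : Type*} (M : MultiTaskMDP S A Subtask)

open Classical in
/-- The stagewise game of the multi-task MDP. Its states are pairs (state, current subtask).
Where the state is not final for the subtask, agent 1 moves the system and the subtask stays;
where it is final, the system jumps and agent 2 chooses the next subtask, at no reward and
without discounting. -/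
def game : MarkovGame (S × Subtask) A Subtask where
  trans x a₁ a₂ :=
    if h : x.1 ∈ M.F x.2 then (M.T x.2 ⟨x.1, h⟩).map (fun s' => (s', a₂))
    else (M.P x.1 a₁).map (fun s' => (s', x.2))
  reward x a := if x.1 ∈ M.F x.2 then 0 else M.R x.2 x.1 a
  discount x := if x.1 ∈ M.F x.2 then 1 else M.γ
  init := M.η.map (fun s => (s, M.σ₀))

/-- The set `S₁` of game states in which agent 1 acts. -/
abbrev S₁ : Type _ := {x : S × Subtask // x.1 ∉ M.F x.2}

instance instFintypeS₁ [Finite S] [Finite Subtask] : Fintype M.S₁ := Fintype.ofFinite _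

open Classical in
/-- `V(s, σ)` for `(s, σ) ∈ S₁`, and the dummy value `0` elsewhere. It is used only under a sum
against `T`, which gives weight zero to all states outside `S₁`. -/
def valueOn (V : M.S₁ → ℝ) (x : S × Subtask) : ℝ :=
  if h : x.1 ∉ M.F x.2 then V ⟨x, h⟩ else 0

open Classical in
/-- The extension of a value function on `S₁` to all states of the game, by the worst case over
the next subtask at final states. -/
def ext [Fintype S] (V : M.S₁ → ℝ) (x : S × Subtask) : ℝ :=
  if h : x.1 ∈ M.F x.2 then
    ⨅ σ' : Subtask, ∑ s' : S, (M.T x.2 ⟨x.1, h⟩ s').toReal * M.valueOn V (s', σ')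
  else V ⟨x, h⟩

/-- The Bellman operator of the game, on value functions over `S₁`. -/
def bellman [Fintype S] (V : M.S₁ → ℝ) : M.S₁ → ℝ := fun x =>
  ⨆ a : A, (M.game.reward x.1 a +
    M.γ * ∑ s' : S, (M.P x.1.1 a s').toReal * M.ext V (s', x.1.2))

/-- The restriction of the optimal value function of the game to `S₁`. -/
def optValueS₁ : M.S₁ → ℝ := fun x => M.game.optValue x.1

end MultiTaskMDP

end

/-! Worst-case extension takes minima and averages, both nonexpansive in the sup norm, and the
factor `γ` then makes `bellman` a contraction. Banach gives existence of a fixed point and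
convergence of iterates; what remains is to identify any fixed point `V` with the optimal value. The
obstacle is that final states are undiscounted. Jumps never land in a final state, so two
consecutive steps always contain a factor `γ`; the weight that is `1/√γ` at final states and `1`
elsewhere turns this into a one-step contraction with factor `√γ` (`stepOp_weight_le`). Hence the
reward series converges, values satisfy the policy evaluation equation, and a comparison principle
holds (`nonpos_of_le_stepOp`). Greedy choices against `M.ext V` form a saddle point, so
`optValue_eq_of_saddle` gives `optValue = M.ext V`. -/

/-- The expected discounted value of `f` at time `t` along a homogeneous Markov chain on a finite
space is obtained by iterating the discounted transition operator. -/
theorem integral_traj_prod_mul {X : Type*} [Finite X] [MeasurableSpace X]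
    [DiscreteMeasurableSpace X] (κ : Kernel X X) [IsMarkovKernel κ] (d : X → ℝ) (x : X) (t : ℕ)
    (f : X → ℝ) :
    Integrable (fun s : ℕ → X => (∏ k ∈ Finset.range t, d (s k)) * f (s t))
      (Kernel.traj (X := fun _ : ℕ => X) (fun n => κ.comap
        (fun h : (i : Finset.Iic n) → X => h ⟨n, Finset.mem_Iic.2 le_rfl⟩)
        (measurable_pi_apply _)) 0 (fun _ => x)) ∧
    ∫ s, (∏ k ∈ Finset.range t, d (s k)) * f (s t)
      ∂(Kernel.traj (X := fun _ : ℕ => X) (fun n => κ.comap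
        (fun h : (i : Finset.Iic n) → X => h ⟨n, Finset.mem_Iic.2 le_rfl⟩)
        (measurable_pi_apply _)) 0 (fun _ => x)) =
      ((fun (g : X → ℝ) y => d y * ∫ z, g z ∂κ y)^[t] f) x := by
  induction t generalizing f with
  | zero =>
    set K : (n : ℕ) → Kernel ((i : Finset.Iic n) → X) X := fun n => κ.comap
        (fun h : (i : Finset.Iic n) → X => h ⟨n, Finset.mem_Iic.2 le_rfl⟩)
        (measurable_pi_apply _)
    have hmap := Kernel.traj_map_frestrictLe_apply (X := fun _ : ℕ => X) (κ := K) 0 0 (fun _ => x)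
    set φ : (Finset.Iic 0 → X) → ℝ := fun u => f (u ⟨0, Finset.mem_Iic.2 le_rfl⟩)
    have hφ : (fun s : ℕ → X => (∏ k ∈ Finset.range 0, d (s k)) * f (s 0)) =
        fun s => φ (Preorder.frestrictLe (π := fun _ : ℕ => X) 0 s) := by
      ext s; simp [φ]
    have hm : Measurable (Preorder.frestrictLe (π := fun _ : ℕ => X) 0) :=
      Preorder.measurable_frestrictLe 0
    rw [hφ]
    constructor
    · exact (Integrable.of_finite (f := φ)).comp_measurable hm
    · rw [← integral_map (f := φ) hm.aemeasurable (measurable_of_finite φ).aestronglyMeasurable,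
        hmap]
      simp [φ, Kernel.id_apply]
  | succ t ih =>
    set K : (n : ℕ) → Kernel ((i : Finset.Iic n) → X) X := fun n => κ.comap
        (fun h : (i : Finset.Iic n) → X => h ⟨n, Finset.mem_Iic.2 le_rfl⟩)
        (measurable_pi_apply _) with hK
    have hpair := Kernel.partialTraj_compProd_eq_map_traj (X := fun _ : ℕ => X) (κ := K)
      (a := 0) (b := t) (Nat.zero_le t) (x₀ := fun _ => x)
    have hmap := Kernel.traj_map_frestrictLe_apply (X := fun _ : ℕ => X) (κ := K) 0 t (fun _ => x)
    set φ : (Finset.Iic t → X) × X → ℝ := fun u => (∏ i, d (u.1 i)) * f u.2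
    have hφ : (fun s : ℕ → X => (∏ k ∈ Finset.range (t + 1), d (s k)) * f (s (t + 1))) =
        fun s => φ (Preorder.frestrictLe (π := fun _ : ℕ => X) t s, s (t + 1)) := by
      ext s
      simp only [φ, Preorder.frestrictLe_apply]
      rw [Finset.prod_coe_sort (Finset.Iic t) (fun k => d (s k)), Nat.range_succ_eq_Iic]
    have hm : Measurable fun s : ℕ → X =>
        (Preorder.frestrictLe (π := fun _ : ℕ => X) t s, s (t + 1)) :=
      (Preorder.measurable_frestrictLe t).prodMk (measurable_pi_apply _)
    have hm' : Measurable (Preorder.frestrictLe (π := fun _ : ℕ => X) t) :=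
      Preorder.measurable_frestrictLe t
    rw [hφ]
    constructor
    · exact (Integrable.of_finite (f := φ)).comp_measurable hm
    -- Condition on the history up to time `t`: the last transition turns `f` into `κ f`. The
    -- operator next to `f` is the one peeled off, so the induction hypothesis is needed at a new
    -- function.
    · rw [← integral_map (f := φ) hm.aemeasurable (measurable_of_finite φ).aestronglyMeasurable,
        ← hpair, Measure.integral_compProd Integrable.of_finite, ← hmap,
        integral_map hm'.aemeasurable (measurable_of_finite _).aestronglyMeasurable,
        Function.iterate_succ_apply, ← (ih _).2]
      congr 1
      ext s
      simp only [φ, hK, Preorder.frestrictLe_apply, Kernel.comap_apply, integral_const_mul]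
      rw [Finset.prod_coe_sort (Finset.Iic t) (fun k => d (s k)), ← Nat.range_succ_eq_Iic,
        Finset.prod_range_succ, mul_assoc]

/-! ### Finite expectations -/

namespace PMF

/-- The expectation of a real function under a probability mass function on a finite type. -/
noncomputable def expect {X : Type*} [Fintype X] (p : PMF X) (f : X → ℝ) : ℝ :=
  ∑ x, (p x).toReal * f x

variable {X Y : Type*} [Fintype X] [Fintype Y] (p : PMF X)

theorem expect_mono_of_support {f g : X → ℝ} (h : ∀ x, p x ≠ 0 → f x ≤ g x) :
    p.expect f ≤ p.expect g := by
  refine Finset.sum_le_sum fun x _ => ?_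
  by_cases hx : p x = 0
  · simp [hx]
  · exact mul_le_mul_of_nonneg_left (h x hx) ENNReal.toReal_nonneg

theorem expect_mono {f g : X → ℝ} (h : ∀ x, f x ≤ g x) : p.expect f ≤ p.expect g :=
  p.expect_mono_of_support fun x _ => h x

theorem expect_const (c : ℝ) : p.expect (fun _ => c) = c := by
  have h : ∑ x, (p x).toReal = 1 := by
    rw [← ENNReal.toReal_sum fun x _ => p.apply_ne_top x, ← tsum_fintype (L := .unconditional _),
      p.tsum_coe, ENNReal.toReal_one]
  rw [expect, ← Finset.sum_mul, h, one_mul]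

theorem expect_congr_of_support {f g : X → ℝ} (h : ∀ x, p x ≠ 0 → f x = g x) :
    p.expect f = p.expect g :=
  (p.expect_mono_of_support fun x hx => (h x hx).le).antisymm
    (p.expect_mono_of_support fun x hx => (h x hx).ge)

theorem expect_add (f g : X → ℝ) : p.expect (fun x => f x + g x) = p.expect f + p.expect g := by
  simp [expect, mul_add, Finset.sum_add_distrib]

theorem expect_add_const (f : X → ℝ) (c : ℝ) :
    p.expect (fun x => f x + c) = p.expect f + c := by
  rw [expect_add, expect_const]

theorem expect_sub (f g : X → ℝ) : p.expect (fun x => f x - g x) = p.expect f - p.expect g := by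
  simp [expect, mul_sub, Finset.sum_sub_distrib]

theorem expect_const_mul (c : ℝ) (f : X → ℝ) :
    p.expect (fun x => c * f x) = c * p.expect f := by
  simp [expect, Finset.mul_sum, mul_left_comm]

theorem expect_map (g : X → Y) (f : Y → ℝ) : (p.map g).expect f = p.expect (fun x => f (g x)) := by
  let mX : MeasurableSpace X := ⊤
  let mY : MeasurableSpace Y := ⊤
  have hg : Measurable g := measurable_from_top
  have h := integral_map (μ := p.toMeasure) (f := f) hg.aemeasurable
    (measurable_of_finite f).aestronglyMeasurable
  rw [PMF.toMeasure_map g p hg, PMF.integral_eq_sum, PMF.integral_eq_sum] at h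
  exact h

end PMF

/-! ### Markov games with a weighted contraction -/

namespace MarkovGame

variable {X A₁ A₂ : Type*} [Fintype X] (G : MarkovGame X A₁ A₂)

/-- The discounted transition operator under the policies `π₁`, `π₂`. -/
noncomputable def stepOp (π₁ : X → A₁) (π₂ : X → A₂) (f : X → ℝ) (x : X) : ℝ :=
  G.discount x * (G.trans x (π₁ x) (π₂ x)).expect f

theorem integral_stateLaw (π₁ : X → A₁) (π₂ : X → A₂) (x : X) (t : ℕ) (f : X → ℝ) :
    @Integrable _ _ _ _ (seqSpace X)
      (fun s : ℕ → X => (∏ k ∈ Finset.range t, G.discount (s k)) * f (s t))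
      (G.stateLaw π₁ π₂ x) ∧
    @integral _ ℝ _ _ (seqSpace X) (G.stateLaw π₁ π₂ x)
      (fun s : ℕ → X => (∏ k ∈ Finset.range t, G.discount (s k)) * f (s t)) =
      ((G.stepOp π₁ π₂)^[t] f) x := by
  let mX : MeasurableSpace X := ⊤
  have h := integral_traj_prod_mul (G.stepKernel π₁ π₂) G.discount x t f
  have hop : (fun (g : X → ℝ) y => G.discount y * ∫ z, g z ∂(G.stepKernel π₁ π₂) y) =
      G.stepOp π₁ π₂ := by
    ext g y
    exact congrArg _ (PMF.integral_eq_sum (G.trans y (π₁ y) (π₂ y)) g)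
  rw [hop] at h
  exact h

theorem integral_runLaw (π₁ : X → A₁) (π₂ : X → A₂) (x : X) (t : ℕ) (f : X → A₁ → ℝ) :
    @Integrable _ _ _ _ (seqSpace (X × A₁ × A₂))
      (fun ρ : ℕ → X × A₁ × A₂ =>
        (∏ k ∈ Finset.range t, G.discount (ρ k).1) * f (ρ t).1 (ρ t).2.1)
      (G.runLaw π₁ π₂ x) ∧
    @integral _ ℝ _ _ (seqSpace (X × A₁ × A₂)) (G.runLaw π₁ π₂ x)
      (fun ρ : ℕ → X × A₁ × A₂ =>
        (∏ k ∈ Finset.range t, G.discount (ρ k).1) * f (ρ t).1 (ρ t).2.1) =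
      ((G.stepOp π₁ π₂)^[t] fun y => f y (π₁ y)) x := by
  have h := G.integral_stateLaw π₁ π₂ x t fun y => f y (π₁ y)
  let mX : MeasurableSpace X := ⊤
  let mY : MeasurableSpace (X × A₁ × A₂) := ⊤
  have hm : Measurable fun (s : ℕ → X) (t : ℕ) => (s t, π₁ (s t), π₂ (s t)) :=
    measurable_pi_lambda _ fun n => Measurable.comp (g := fun y : X => (y, π₁ y, π₂ y))
      measurable_from_top (measurable_pi_apply n)
  have hF : Measurable fun ρ : ℕ → X × A₁ × A₂ =>
      (∏ k ∈ Finset.range t, G.discount (ρ k).1) * f (ρ t).1 (ρ t).2.1 := by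
    refine Measurable.mul (Finset.measurable_fun_prod _ fun k _ => ?_) ?_
    · exact Measurable.comp (g := fun y : X × A₁ × A₂ => G.discount y.1)
        measurable_from_top (measurable_pi_apply k)
    · exact Measurable.comp (g := fun y : X × A₁ × A₂ => f y.1 y.2.1)
        measurable_from_top (measurable_pi_apply t)
  refine ⟨?_, ?_⟩
  · exact (integrable_map_measure hF.aestronglyMeasurable hm.aemeasurable).2 h.1
  · exact (integral_map hm.aemeasurable hF.aestronglyMeasurable).trans h.2

variable {G} {w : X → ℝ} {β : ℝ}

theorem stepOp_mono (hd : ∀ x, 0 ≤ G.discount x) (π₁ : X → A₁) (π₂ : X → A₂) {f g : X → ℝ}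
    (h : ∀ x, f x ≤ g x) (x : X) : G.stepOp π₁ π₂ f x ≤ G.stepOp π₁ π₂ g x :=
  mul_le_mul_of_nonneg_left (PMF.expect_mono _ h) (hd x)

theorem stepOp_sub (π₁ : X → A₁) (π₂ : X → A₂) (f g : X → ℝ) (x : X) :
    G.stepOp π₁ π₂ (fun y => f y - g y) x = G.stepOp π₁ π₂ f x - G.stepOp π₁ π₂ g x := by
  simp only [stepOp, PMF.expect_sub, mul_sub]

/-- The operator is monotone and shrinks `w` by `β`, so a bound by a multiple of `w` improves
geometrically. -/
theorem iterate_stepOp_le (hd : ∀ x, 0 ≤ G.discount x) (hβ : 0 ≤ β)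
    {π₁ : X → A₁} {π₂ : X → A₂} (hw : ∀ x, G.stepOp π₁ π₂ w x ≤ β * w x) {f : X → ℝ} {C : ℝ}
    (hC : 0 ≤ C) (hf : ∀ x, f x ≤ C * w x) (t : ℕ) (x : X) :
    ((G.stepOp π₁ π₂)^[t] f) x ≤ C * β ^ t * w x := by
  induction t generalizing x with
  | zero => simpa using hf x
  | succ t ih =>
    rw [Function.iterate_succ_apply']
    calc _ ≤ G.stepOp π₁ π₂ (fun y => C * β ^ t * w y) x := stepOp_mono hd π₁ π₂ ih x
      _ = C * β ^ t * G.stepOp π₁ π₂ w x := by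
        simp only [stepOp, PMF.expect_const_mul]; ring
      _ ≤ C * β ^ t * (β * w x) := mul_le_mul_of_nonneg_left (hw x) (by positivity)
      _ = _ := by ring

theorem exists_le_mul_of_pos (hpos : ∀ x, 0 < w x) (f : X → ℝ) :
    ∃ C, 0 ≤ C ∧ ∀ x, f x ≤ C * w x := by
  refine ⟨∑ y, |f y| / w y, Finset.sum_nonneg fun y _ => by have := hpos y; positivity,
    fun x => ?_⟩
  rw [← div_le_iff₀ (hpos x)]
  calc f x / w x ≤ |f x| / w x := div_le_div_of_nonneg_right (le_abs_self _) (hpos x).le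
    _ ≤ _ := Finset.single_le_sum (f := fun y => |f y| / w y)
      (fun y _ => by have := hpos y; positivity) (Finset.mem_univ x)

/-- Under a weighted contraction bound, the value is the sum of the expected discounted rewards. -/
theorem hasSum_value (hd : ∀ x, 0 ≤ G.discount x) (hβ : 0 ≤ β) (hβ1 : β < 1)
    (hpos : ∀ x, 0 < w x) {π₁ : X → A₁} {π₂ : X → A₂}
    (hw : ∀ x, G.stepOp π₁ π₂ w x ≤ β * w x) (x : X) :
    HasSum (fun t => ((G.stepOp π₁ π₂)^[t] fun y => G.reward y (π₁ y)) x) (G.value π₁ π₂ x) := by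
  have hint := fun t => G.integral_runLaw π₁ π₂ x t G.reward
  -- Discounts are nonnegative, so the norm of each term is the same expression with `|reward|`; its
  -- geometric decay justifies exchanging sum and integral.
  have habs := fun t => G.integral_runLaw π₁ π₂ x t fun y a => |G.reward y a|
  let mY : MeasurableSpace (X × A₁ × A₂) := ⊤
  have hnorm : ∀ t, (∫ ρ, ‖(∏ k ∈ Finset.range t, G.discount (ρ k).1) *
      G.reward (ρ t).1 (ρ t).2.1‖ ∂(G.runLaw π₁ π₂ x)) =
      ((G.stepOp π₁ π₂)^[t] fun y => |G.reward y (π₁ y)|) x := fun t => by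
    rw [← (habs t).2]
    congr 1
    ext ρ
    rw [norm_mul, Real.norm_of_nonneg (Finset.prod_nonneg fun k _ => hd _), Real.norm_eq_abs]
  obtain ⟨C, hC, hle⟩ := exists_le_mul_of_pos hpos fun y => |G.reward y (π₁ y)|
  have hsum := hasSum_integral_of_summable_integral_norm (μ := G.runLaw π₁ π₂ x)
    (F := fun t ρ => (∏ k ∈ Finset.range t, G.discount (ρ k).1) * G.reward (ρ t).1 (ρ t).2.1)
    (fun t => (hint t).1) ?_
  · exact hsum.congr_fun fun t => (hint t).2.symm
  · refine Summable.of_nonneg_of_le (fun t => integral_nonneg fun _ => norm_nonneg _)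
      (fun t => (hnorm t).le.trans (iterate_stepOp_le hd hβ hw hC hle t x)) ?_
    exact ((summable_geometric_of_lt_one hβ hβ1).mul_left C).mul_right (w x)

/-- Split off the time-zero term; the operator is a finite sum, so it passes through the series. -/
theorem value_eq_reward_add_stepOp (hd : ∀ x, 0 ≤ G.discount x) (hβ : 0 ≤ β) (hβ1 : β < 1)
    (hpos : ∀ x, 0 < w x) {π₁ : X → A₁} {π₂ : X → A₂}
    (hw : ∀ x, G.stepOp π₁ π₂ w x ≤ β * w x) (x : X) :
    G.value π₁ π₂ x = G.reward x (π₁ x) + G.stepOp π₁ π₂ (G.value π₁ π₂) x := by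
  have h := fun y => hasSum_value hd hβ hβ1 hpos hw y
  have h1 := (hasSum_nat_add_iff' 1).2 (h x)
  have h2 : HasSum (fun t => ((G.stepOp π₁ π₂)^[t + 1] fun y => G.reward y (π₁ y)) x)
      (G.stepOp π₁ π₂ (G.value π₁ π₂) x) := by
    simp only [Function.iterate_succ_apply']
    exact (hasSum_sum fun y _ => (h y).mul_left _).mul_left _
  have := h1.unique h2
  simp only [Finset.range_one, Finset.sum_singleton, Function.iterate_zero, id] at this
  linarith

/-- Comparison principle: iterating the hypothesis bounds `g` by `C * β ^ t * w`, which tends to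
zero. -/
theorem nonpos_of_le_stepOp (hd : ∀ x, 0 ≤ G.discount x) (hβ : 0 ≤ β) (hβ1 : β < 1)
    (hpos : ∀ x, 0 < w x) {π₁ : X → A₁} {π₂ : X → A₂}
    (hw : ∀ x, G.stepOp π₁ π₂ w x ≤ β * w x) {g : X → ℝ} (hg : ∀ x, g x ≤ G.stepOp π₁ π₂ g x)
    (x : X) : g x ≤ 0 := by
  obtain ⟨C, hC, hle⟩ := exists_le_mul_of_pos hpos g
  have hit : ∀ t y, g y ≤ ((G.stepOp π₁ π₂)^[t] g) y := fun t => by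
    induction t with
    | zero => exact fun y => le_rfl
    | succ t ih =>
      intro y
      rw [Function.iterate_succ_apply']
      exact (hg y).trans (stepOp_mono hd π₁ π₂ ih y)
  have hlim : Tendsto (fun t => C * β ^ t * w x) atTop (𝓝 0) := by
    simpa using ((tendsto_pow_atTop_nhds_zero_of_lt_one hβ hβ1).const_mul C).mul_const (w x)
  exact ge_of_tendsto' hlim fun t => (hit t x).trans (iterate_stepOp_le hd hβ hw hC hle t x)

/-- A function for which each agent has a policy that guarantees it in one step is the optimal
value. -/
theorem optValue_eq_of_saddle [Finite A₁] [Finite A₂] (hd : ∀ x, 0 ≤ G.discount x)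
    (hβ : 0 ≤ β) (hβ1 : β < 1) (hpos : ∀ x, 0 < w x)
    (hw : ∀ (π₁ : X → A₁) (π₂ : X → A₂) x, G.stepOp π₁ π₂ w x ≤ β * w x) {U : X → ℝ}
    {p₁ : X → A₁} {p₂ : X → A₂}
    (h₁ : ∀ π₂ x, U x ≤ G.reward x (p₁ x) + G.stepOp p₁ π₂ U x)
    (h₂ : ∀ π₁ x, G.reward x (π₁ x) + G.stepOp π₁ p₂ U x ≤ U x) (x : X) :
    G.optValue x = U x := by
  have hle : ∀ π₂, U x ≤ G.value p₁ π₂ x := fun π₂ => by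
    refine sub_nonpos.1 (nonpos_of_le_stepOp hd hβ hβ1 hpos (hw p₁ π₂)
      (g := fun y => U y - G.value p₁ π₂ y) (fun y => ?_) x)
    rw [stepOp_sub]
    linarith [h₁ π₂ y, value_eq_reward_add_stepOp hd hβ hβ1 hpos (hw p₁ π₂) y]
  have hge : ∀ π₁, G.value π₁ p₂ x ≤ U x := fun π₁ => by
    refine sub_nonpos.1 (nonpos_of_le_stepOp hd hβ hβ1 hpos (hw π₁ p₂)
      (g := fun y => G.value π₁ p₂ y - U y) (fun y => ?_) x)
    rw [stepOp_sub]
    linarith [h₂ π₁ y, value_eq_reward_add_stepOp hd hβ hβ1 hpos (hw π₁ p₂) y]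
  have : Nonempty (X → A₁) := ⟨p₁⟩
  have : Nonempty (X → A₂) := ⟨p₂⟩
  -- `p₂` caps every inner infimum at `U x`, and `p₁` attains at least `U x`.
  refine le_antisymm (ciSup_le fun π₁ => ?_) ?_
  · exact (ciInf_le (Set.finite_range _).bddBelow p₂).trans (hge π₁)
  · exact (le_ciInf hle).trans (le_ciSup (f := fun π₁ => ⨅ π₂, G.value π₁ π₂ x)
      (Set.finite_range _).bddAbove p₁)

end MarkovGame

theorem ciInf_le_ciInf_add_of_forall_le {ι : Type*} [Finite ι] [Nonempty ι] {f g : ι → ℝ} {c : ℝ}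
    (h : ∀ i, f i ≤ g i + c) : ⨅ i, f i ≤ (⨅ i, g i) + c := by
  rw [← sub_le_iff_le_add]
  exact le_ciInf fun i => sub_le_iff_le_add.2
    ((ciInf_le (Set.finite_range f).bddBelow i).trans (h i))

theorem ciSup_le_ciSup_add_of_forall_le {ι : Type*} [Finite ι] [Nonempty ι] {f g : ι → ℝ} {c : ℝ}
    (h : ∀ i, f i ≤ g i + c) : ⨆ i, f i ≤ (⨆ i, g i) + c :=
  ciSup_le fun i => (h i).trans (by gcongr; exact le_ciSup (Set.finite_range g).bddAbove i)

/-! ### The stagewise game and its Bellman operator -/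

namespace MultiTaskMDP

variable {S A Subtask : Type*} (M : MultiTaskMDP S A Subtask)

theorem valueOn_of_notMem (V : M.S₁ → ℝ) {x : S × Subtask} (h : x.1 ∉ M.F x.2) :
    M.valueOn V x = V ⟨x, h⟩ := dif_pos h

theorem valueOn_of_mem (V : M.S₁ → ℝ) {x : S × Subtask} (h : x.1 ∈ M.F x.2) :
    M.valueOn V x = 0 := dif_neg (not_not.2 h)

theorem notMem_of_T_ne_zero {σ : Subtask} {s : M.F σ} {s' : S} (h : M.T σ s s' ≠ 0)
    (σ' : Subtask) : s' ∉ M.F σ' := fun hs => h (M.T_eq_zero σ s σ' s' hs)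

theorem discount_of_mem {x : S × Subtask} (h : x.1 ∈ M.F x.2) : M.game.discount x = 1 := if_pos h

theorem discount_of_notMem {x : S × Subtask} (h : x.1 ∉ M.F x.2) :
    M.game.discount x = M.γ := if_neg h

theorem reward_of_mem {x : S × Subtask} (h : x.1 ∈ M.F x.2) (a : A) :
    M.game.reward x a = 0 := if_pos h

theorem discount_nonneg (x : S × Subtask) : 0 ≤ M.game.discount x := by
  by_cases h : x.1 ∈ M.F x.2
  · rw [M.discount_of_mem h]; exact zero_le_one
  · rw [M.discount_of_notMem h]; exact M.γ_pos.le

variable [Fintype S]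

theorem ext_of_mem (V : M.S₁ → ℝ) {x : S × Subtask} (h : x.1 ∈ M.F x.2) :
    M.ext V x =
      ⨅ σ', (M.T x.2 ⟨x.1, h⟩).expect fun s' => M.valueOn V (s', σ') := dif_pos h

theorem ext_of_notMem (V : M.S₁ → ℝ) {x : S × Subtask} (h : x.1 ∉ M.F x.2) :
    M.ext V x = V ⟨x, h⟩ := dif_neg h

theorem bellman_apply (V : M.S₁ → ℝ) (x : M.S₁) :
    M.bellman V x = ⨆ a, (M.game.reward x.1 a +
      M.γ * (M.P x.1.1 a).expect fun s' => M.ext V (s', x.1.2)) := rfl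

/-- At a final state the worst-case extension may be evaluated at the states after the jump. -/
theorem ext_eq_iInf_ext (V : M.S₁ → ℝ) {x : S × Subtask} (h : x.1 ∈ M.F x.2) :
    M.ext V x = ⨅ σ', (M.T x.2 ⟨x.1, h⟩).expect fun s' => M.ext V (s', σ') := by
  rw [M.ext_of_mem V h]
  refine iInf_congr fun σ' => PMF.expect_congr_of_support _ fun s' hs' => ?_
  have hn : (s', σ').1 ∉ M.F (s', σ').2 := M.notMem_of_T_ne_zero hs' σ'
  rw [M.valueOn_of_notMem V hn, M.ext_of_notMem V hn]

section stepOp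

variable [Fintype Subtask]

theorem stepOp_of_mem (π₁ : S × Subtask → A) (π₂ : S × Subtask → Subtask) (f : S × Subtask → ℝ)
    {x : S × Subtask} (h : x.1 ∈ M.F x.2) :
    M.game.stepOp π₁ π₂ f x = (M.T x.2 ⟨x.1, h⟩).expect fun s' => f (s', π₂ x) := by
  have ht : M.game.trans x (π₁ x) (π₂ x) = (M.T x.2 ⟨x.1, h⟩).map (fun s' => (s', π₂ x)) :=
    dif_pos h
  rw [MarkovGame.stepOp, M.discount_of_mem h, ht, PMF.expect_map, one_mul]

theorem stepOp_of_notMem (π₁ : S × Subtask → A) (π₂ : S × Subtask → Subtask)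
    (f : S × Subtask → ℝ) {x : S × Subtask} (h : x.1 ∉ M.F x.2) :
    M.game.stepOp π₁ π₂ f x = M.γ * (M.P x.1 (π₁ x)).expect fun s' => f (s', x.2) := by
  have ht : M.game.trans x (π₁ x) (π₂ x) = (M.P x.1 (π₁ x)).map (fun s' => (s', x.2)) :=
    dif_neg h
  rw [MarkovGame.stepOp, M.discount_of_notMem h, ht, PMF.expect_map]

open Classical in
/-- A weight for which the discounted transition operator contracts with factor `√γ`, although
final states are not discounted. -/
noncomputable def weight (x : S × Subtask) : ℝ := if x.1 ∈ M.F x.2 then (√M.γ)⁻¹ else 1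

omit [Fintype S] [Fintype Subtask] in
theorem weight_pos (x : S × Subtask) : 0 < M.weight x := by
  have := Real.sqrt_pos.2 M.γ_pos
  unfold weight
  split_ifs <;> positivity

/-- A jump lowers the weight from `1/√γ` to `1`, a factor `√γ`; elsewhere the weight rises to at
most `1/√γ`, and `γ * (1/√γ) = √γ`. -/
theorem stepOp_weight_le (π₁ : S × Subtask → A) (π₂ : S × Subtask → Subtask) (x : S × Subtask) :
    M.game.stepOp π₁ π₂ M.weight x ≤ √M.γ * M.weight x := by
  have h0 := Real.sqrt_pos.2 M.γ_pos
  have h1 : 1 ≤ (√M.γ)⁻¹ :=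
    (one_le_inv₀ h0).2 (Real.sqrt_le_one.2 M.γ_lt_one.le)
  by_cases h : x.1 ∈ M.F x.2
  · rw [M.stepOp_of_mem π₁ π₂ _ h, weight, if_pos h, mul_inv_cancel₀ h0.ne',
      ← PMF.expect_const (M.T x.2 ⟨x.1, h⟩) 1]
    exact PMF.expect_mono_of_support _ fun s' hs' => (if_neg (M.notMem_of_T_ne_zero hs' _)).le
  · rw [M.stepOp_of_notMem π₁ π₂ _ h, weight, if_neg h, mul_one]
    calc _ ≤ M.γ * (√M.γ)⁻¹ := by
          refine mul_le_mul_of_nonneg_left ?_ M.γ_pos.le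
          rw [← PMF.expect_const (M.P x.1 (π₁ x)) (√M.γ)⁻¹]
          refine PMF.expect_mono _ fun s' => ?_
          rw [weight]
          split_ifs
          · exact le_rfl
          · exact h1
      _ = √M.γ := by
          rw [← div_eq_mul_inv, Real.div_sqrt]

end stepOp

variable [Finite A] [Nonempty A] [Finite Subtask]

omit [Finite A] [Nonempty A] in
-- Minima and averages preserve a uniform shift. Where `valueOn` is the dummy `0` on both sides, `0
-- ≤ c` is what is needed.
theorem ext_le_ext_add {V W : M.S₁ → ℝ} {c : ℝ} (hc : 0 ≤ c) (h : ∀ x, V x ≤ W x + c)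
    (x : S × Subtask) : M.ext V x ≤ M.ext W x + c := by
  have : Nonempty Subtask := ⟨x.2⟩
  by_cases hx : x.1 ∈ M.F x.2
  · rw [M.ext_of_mem V hx, M.ext_of_mem W hx]
    refine ciInf_le_ciInf_add_of_forall_le fun σ' => ?_
    rw [← PMF.expect_add_const]
    refine PMF.expect_mono _ fun s' => ?_
    by_cases hs : (s', σ').1 ∈ M.F (s', σ').2
    · rw [M.valueOn_of_mem V hs, M.valueOn_of_mem W hs]; simpa using hc
    · rw [M.valueOn_of_notMem V hs, M.valueOn_of_notMem W hs]; exact h _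
  · rw [M.ext_of_notMem V hx, M.ext_of_notMem W hx]; exact h _

theorem bellman_le_bellman_add {V W : M.S₁ → ℝ} {c : ℝ} (hc : 0 ≤ c) (h : ∀ x, V x ≤ W x + c)
    (x : M.S₁) : M.bellman V x ≤ M.bellman W x + M.γ * c := by
  rw [bellman_apply, bellman_apply]
  refine ciSup_le_ciSup_add_of_forall_le fun a => ?_
  rw [add_assoc, ← mul_add, ← PMF.expect_add_const]
  gcongr
  · exact M.γ_pos.le
  · exact PMF.expect_mono _ fun s' => M.ext_le_ext_add hc h _

theorem contractingWith_bellman : ContractingWith M.γ.toNNReal M.bellman := by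
  refine ⟨Real.toNNReal_lt_one.2 M.γ_lt_one, LipschitzWith.of_dist_le_mul fun V W => ?_⟩
  rw [Real.coe_toNNReal _ M.γ_pos.le]
  refine (dist_pi_le_iff (mul_nonneg M.γ_pos.le dist_nonneg)).2 fun x => ?_
  have h : ∀ (V W : M.S₁ → ℝ) y, V y ≤ W y + dist V W := fun V W y => by
    have := (le_abs_self (V y - W y)).trans (dist_le_pi_dist V W y)
    linarith
  have h1 := M.bellman_le_bellman_add dist_nonneg (h V W) x
  have h2 := M.bellman_le_bellman_add dist_nonneg (h W V) x
  rw [dist_comm W V] at h2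
  rw [Real.dist_eq, abs_le]
  constructor <;> linarith

/-- The worst-case extension of a fixed point of the Bellman operator is the optimal value of the
game, at all its states. -/
theorem optValue_eq_ext_of_isFixedPt {V : M.S₁ → ℝ} (hV : Function.IsFixedPt M.bellman V)
    (x : S × Subtask) : M.game.optValue x = M.ext V x := by
  have := Fintype.ofFinite Subtask
  have : Nonempty Subtask := ⟨x.2⟩
  -- Both policies are greedy; the choices of `p₁` at final states and of `p₂` elsewhere do not
  -- matter.
  choose p₁ hp₁ using fun y : S × Subtask => Finite.exists_max fun a =>
    M.game.reward y a + M.γ * (M.P y.1 a).expect fun s' => M.ext V (s', y.2)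
  have hex : ∀ y : S × Subtask, ∃ σ, ∀ (h : y.1 ∈ M.F y.2) (σ' : Subtask),
      ((M.T y.2 ⟨y.1, h⟩).expect fun s' => M.ext V (s', σ)) ≤
        (M.T y.2 ⟨y.1, h⟩).expect fun s' => M.ext V (s', σ') := fun y => by
    by_cases h : y.1 ∈ M.F y.2
    · obtain ⟨σ, hσ⟩ := Finite.exists_min fun σ' =>
        (M.T y.2 ⟨y.1, h⟩).expect fun s' => M.ext V (s', σ')
      exact ⟨σ, fun _ => hσ⟩
    · exact ⟨y.2, fun h' => absurd h' h⟩
  choose p₂ hp₂ using hex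
  have hext : ∀ {y : S × Subtask}, y.1 ∉ M.F y.2 → M.ext V y = ⨆ a, (M.game.reward y a +
      M.γ * (M.P y.1 a).expect fun s' => M.ext V (s', y.2)) := fun {y} h => by
    rw [M.ext_of_notMem V h, ← M.bellman_apply V ⟨y, h⟩, hV.eq]
  refine MarkovGame.optValue_eq_of_saddle (p₁ := p₁) (p₂ := p₂) M.discount_nonneg
    (Real.sqrt_nonneg M.γ) ((Real.sqrt_lt' one_pos).2 (by simpa using M.γ_lt_one)) M.weight_pos
    M.stepOp_weight_le (fun π₂ y => ?_) (fun π₁ y => ?_) x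
  · by_cases h : y.1 ∈ M.F y.2
    · rw [M.stepOp_of_mem _ _ _ h, M.reward_of_mem h, zero_add, M.ext_eq_iInf_ext V h]
      exact ciInf_le (Set.finite_range _).bddBelow (π₂ y)
    · rw [M.stepOp_of_notMem _ _ _ h, hext h]
      exact ciSup_le (hp₁ y)
  · by_cases h : y.1 ∈ M.F y.2
    · rw [M.stepOp_of_mem _ _ _ h, M.reward_of_mem h, zero_add, M.ext_eq_iInf_ext V h]
      exact le_ciInf (hp₂ y h)
    · rw [M.stepOp_of_notMem _ _ _ h, hext h]
      exact le_ciSup (f := fun a => M.game.reward y a +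
        M.γ * (M.P y.1 a).expect fun s' => M.ext V (s', y.2)) (Set.finite_range _).bddAbove (π₁ y)

theorem optValueS₁_eq_of_isFixedPt {V : M.S₁ → ℝ} (hV : Function.IsFixedPt M.bellman V) :
    M.optValueS₁ = V :=
  funext fun x => (M.optValue_eq_ext_of_isFixedPt hV x.1).trans (M.ext_of_notMem V x.2)

end MultiTaskMDP

theorem theorem3 {S A Subtask : Type*} [Fintype S] [Finite A] [Nonempty A] [Finite Subtask]
    (M : MultiTaskMDP S A Subtask) :
    ContractingWith M.γ.toNNReal M.bellman ∧
    (∀ V : M.S₁ → ℝ, Function.IsFixedPt M.bellman V ↔ V = M.optValueS₁) ∧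
    (∀ V : M.S₁ → ℝ, Tendsto (fun n : ℕ => M.bellman^[n] V) atTop (𝓝 M.optValueS₁)) := by
  have hc := M.contractingWith_bellman
  have hfix := hc.fixedPoint_isFixedPt
  -- Banach's fixed point is the optimal value, so the optimal value is itself fixed and is the
  -- limit of the iterates.
  have hopt := M.optValueS₁_eq_of_isFixedPt hfix
  refine ⟨hc, fun V => ⟨fun hV => (M.optValueS₁_eq_of_isFixedPt hV).symm, ?_⟩, fun V => ?_⟩
  · rintro rfl
    rwa [hopt]
  · rw [hopt]
    exact hc.tendsto_iterate_fixedPoint V
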